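/- For a subgroup $K$ of a finite group $G$ write $$\Pr(K,G)=\frac{|\{(x,y)\in K\times G : xy=yx\}|}{|K|\,|G|},$$ and write $\Pr(G)=\Pr(G,G)$ for the commuting probability of $G$. For subgroups $T,B\le G$, $[T,B]$ denotes the subgroup generated by all commutators $[t,b]$ with $t\in T$, $b\in B$. (1) For every real $\epsilon>0$ there is a number $N$, depending only on $\epsilon$, such that the following holds. If $G$ is a finite group and $K$ is a subgroup of $G$ with $\Pr(K,G)\ge\epsilon$, then there are a normal subgroup $T$ of $G$ and a subgroup $B\le K$ such that $[G:T]\le N$, $[K:B]\le N$ and $|[T,B]|\le N$. (2) (The case $K=G$: P. M. Neumann's theorem.) For every real $\epsilon>0$ there is a number $N$, depending only on $\epsilon$, such that every finite group $G$ with $\Pr(G)\ge\epsilon$ has a normal subgroup $R$ that is nilpotent of class at most $2$ with $[G:R]\le N$ and $|[R,R]|\le N$. -/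

import Mathlib

universe u

/-- The relative commutativity degree `Pr(K, G)` of a subgroup `K` of a finite group `G`: the
proportion of pairs `(x, y) ∈ K × G` such that `x * y = y * x`. -/
noncomputable def relCommProb {G : Type u} [Group G] (K : Subgroup G) : ℚ :=
  Nat.card {p : K × G // (p.1 : G) * p.2 = p.2 * (p.1 : G)} / (Nat.card K * Nat.card G)

/-! Let `c` be about `2 / ε`. By averaging, the elements of `K` with at most `c` conjugates under
`G` have density at least `1 / c` in `K`. They form a symmetric set, so they generate a subgroup `B`
in at most `3 * c` steps, and every element of `B` has boundedly many conjugates. Exchanging the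
roles of `K` and `G` gives `T` of bounded index whose elements have few conjugates under `K`; pass
to its normal core. Translating a largest `T`-orbit in `B` shows that some `U ≤ B` of bounded index
has few commutators with `T`. Centralizing these commutators makes them commute and have bounded
order, so they generate a bounded group. For Neumann's theorem, intersect `T` and `B`, take the core
`M`, and then the centralizer in `M` of `[M, M]`. -/

open scoped Pointwise

/-! ### Growth of powers of a dense symmetric set. -/

section SymmetricGrowth

variable {G : Type u} [Group G] [Finite G] [DecidableEq G]

/-- In a finite group, a symmetric set `X` containing `1` and of density at least `1 / c` in a
subgroup generates a subgroup in at most `3 * c` steps. -/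
theorem closure_subset_pow_of_card_le {X : Finset G} {H : Subgroup G} {c : ℕ}
    (h1 : 1 ∈ X) (hinv : ∀ x ∈ X, x⁻¹ ∈ X) (hX : (X : Set G) ⊆ H)
    (hc : Nat.card H ≤ c * X.card) {b : G} (hb : b ∈ Subgroup.closure (X : Set G)) :
    b ∈ X ^ (3 * c) := by
  -- Until the powers stabilize, three more factors gain `X.card` elements: for `x` new in `X ^ (3 *
  -- i + 4)`, symmetry of `X` makes `x • X` disjoint from `X ^ (3 * i + 2)`.
  have growth : ∀ i : ℕ, (∃ n ≤ 3 * i, X ^ (n + 1) = X ^ n) ∨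
      (i + 1) * X.card ≤ (X ^ (3 * i + 2)).card := by
    intro i
    induction i with
    | zero =>
      right
      simpa using Finset.card_le_card
        (Finset.pow_subset_pow_right h1 (by norm_num : 1 ≤ 2))
    | succ i ih =>
      rcases ih with ⟨n, hn, h⟩ | ih
      · exact Or.inl ⟨n, by omega, h⟩
      by_cases hs : X ^ (3 * i + 4) = X ^ (3 * i + 3)
      · exact Or.inl ⟨3 * i + 3, by omega, hs⟩
      right
      have hsub : X ^ (3 * i + 3) ⊆ X ^ (3 * i + 4) :=
        Finset.pow_subset_pow_right h1 (by omega)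
      obtain ⟨x, hx, hx'⟩ : ∃ x ∈ X ^ (3 * i + 4), x ∉ X ^ (3 * i + 3) := by
        by_contra! hcon
        exact hs (Finset.Subset.antisymm hcon hsub)
      have hdisj : Disjoint (X ^ (3 * i + 2)) (x • X) := by
        rw [Finset.disjoint_left]
        intro y hy hy'
        obtain ⟨s, hs, rfl⟩ := Finset.mem_smul_finset.mp hy'
        apply hx'
        rw [pow_succ]
        exact Finset.mem_mul.mpr ⟨x • s, hy, s⁻¹, hinv s hs, by simp⟩
      have hle : X ^ (3 * i + 2) ∪ x • X ⊆ X ^ (3 * (i + 1) + 2) := by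
        apply Finset.union_subset
        · exact Finset.pow_subset_pow_right h1 (by omega)
        · intro y hy
          obtain ⟨s, hs, rfl⟩ := Finset.mem_smul_finset.mp hy
          rw [show 3 * (i + 1) + 2 = (3 * i + 4) + 1 by ring, pow_succ]
          exact Finset.mem_mul.mpr ⟨x, hx, s, hs, rfl⟩
      have := Finset.card_le_card hle
      rw [Finset.card_union_of_disjoint hdisj, Finset.card_smul_finset] at this
      linarith
  have hpow : ∀ n, ((X ^ n : Finset G) : Set G) ⊆ H := by
    intro n
    induction n with
    | zero => simp [H.one_mem]
    | succ n ih =>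
      intro y hy
      rw [pow_succ, Finset.mem_coe, Finset.mem_mul] at hy
      obtain ⟨a, ha, d, hd, rfl⟩ := hy
      exact H.mul_mem (ih ha) (hX hd)
  obtain ⟨n, hn, hstab⟩ : ∃ n ≤ 3 * c, X ^ (n + 1) = X ^ n := by
    refine (growth c).resolve_right fun h => ?_
    have h2 : (X ^ (3 * c + 2)).card ≤ Nat.card H := by
      have := Set.ncard_le_ncard (hpow (3 * c + 2)) (Set.toFinite _)
      rw [Set.ncard_coe_finset] at this
      exact this
    have : 0 < X.card := Finset.card_pos.mpr ⟨1, h1⟩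
    nlinarith
  refine Finset.pow_subset_pow_right h1 hn ?_
  induction hb using Subgroup.closure_induction_right with
  | one => exact Finset.one_mem_pow h1
  | mul_right x _ y hy ih =>
    rw [← hstab, pow_succ]
    exact Finset.mem_mul.mpr ⟨x, ih, y, hy, rfl⟩
  | mul_inv_cancel x _ y hy ih =>
    rw [← hstab, pow_succ]
    exact Finset.mem_mul.mpr ⟨x, ih, y⁻¹, hinv y hy, rfl⟩

end SymmetricGrowth

/-! ### Elements with few conjugates. -/

section CentralizerIndex

variable {G : Type u} [Group G]

/-- The conjugacy class of `a` under a subgroup `T` has `|T : C_T(a)|` elements. -/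
theorem ncard_conj_eq_relIndex_centralizer (T : Subgroup G) (a : G) :
    {x | ∃ t ∈ T, t * a * t⁻¹ = x}.ncard = (Subgroup.centralizer {a}).relIndex T := by
  let _ : MulAction T G := MulAction.compHom G ((MulAut.conj (G := G)).comp T.subtype)
  have hs (t : T) : t • a = t * a * (t : G)⁻¹ := rfl
  have h1 : {x | ∃ t ∈ T, t * a * t⁻¹ = x} = MulAction.orbit T a := by
    ext x
    simp only [Set.mem_ofPred_eq, MulAction.mem_orbit_iff, hs, Subtype.exists, exists_prop]
  have h2 : (Subgroup.centralizer {a}).subgroupOf T = MulAction.stabilizer T a := by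
    ext t
    rw [Subgroup.mem_subgroupOf, Subgroup.mem_centralizer_singleton_iff,
      MulAction.mem_stabilizer_iff, hs, mul_inv_eq_iff_eq_mul]
  rw [h1, Subgroup.relIndex, h2, MulAction.index_stabilizer]

theorem relIndex_centralizer_mul_le [Finite G] (K : Subgroup G) (x y : G) :
    (Subgroup.centralizer {x * y}).relIndex K ≤
      (Subgroup.centralizer {x}).relIndex K * (Subgroup.centralizer {y}).relIndex K := by
  refine le_trans (Subgroup.relIndex_le_of_le_left ?_ ?_) Subgroup.relIndex_inf_le
  · intro g hg
    rw [Subgroup.mem_inf, Subgroup.mem_centralizer_singleton_iff,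
      Subgroup.mem_centralizer_singleton_iff] at hg
    rw [Subgroup.mem_centralizer_singleton_iff]
    exact (show Commute g (x * y) from Commute.mul_right hg.1 hg.2)
  · exact Subgroup.FiniteIndex.index_ne_zero

theorem centralizer_singleton_inv (x : G) :
    Subgroup.centralizer {x⁻¹} = Subgroup.centralizer {x} := by
  ext g
  rw [Subgroup.mem_centralizer_singleton_iff, Subgroup.mem_centralizer_singleton_iff]
  exact (Commute.inv_right_iff (a := g) (b := x))

/-- If every element of a finite set has at most `m` conjugates under `K`, then the centralizer
of the set has index at most `m ^ k` in `K`. -/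
theorem relIndex_centralizer_le_pow [Finite G] (K : Subgroup G) {S : Set G} {k m : ℕ}
    (hm : ∀ s ∈ S, (Subgroup.centralizer {s}).relIndex K ≤ m) (hk : S.ncard ≤ k) (hm0 : 0 < m) :
    (Subgroup.centralizer S).relIndex K ≤ m ^ k := by
  have := Fintype.ofFinite S
  have h : Subgroup.centralizer S = ⨅ s : S, Subgroup.centralizer {(s : G)} := by
    ext g
    simp [Subgroup.mem_iInf, Subgroup.mem_centralizer_iff]
  rw [h]
  refine (Subgroup.relIndex_iInf_le _).trans ?_
  refine (Finset.prod_le_pow_card Finset.univ _ m fun s _ => hm s.1 s.2).trans ?_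
  refine Nat.pow_le_pow_right hm0 ?_
  rwa [Finset.card_univ, ← Nat.card_eq_fintype_card]

/-- If, on average over `H`, a proportion of at least `2 / c` of `K` is centralized, then `H` has a
subgroup of index at most `c` all of whose elements have boundedly many conjugates under `K`. -/
theorem exists_le_relIndex_centralizer_le [Finite G] {H K : Subgroup G} {c : ℕ}
    (h : 2 * (Nat.card H * Nat.card K) ≤
      c * {p : G × G | p.1 ∈ H ∧ p.2 ∈ K ∧ Commute p.1 p.2}.ncard) :
    ∃ B ≤ H, B.relIndex H ≤ c ∧ ∀ b ∈ B, (Subgroup.centralizer {b}).relIndex K ≤ c ^ (3 * c) := by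
  classical
  have := Fintype.ofFinite G
  have hc : 0 < c := by
    rcases Nat.eq_zero_or_pos c with rfl | hc
    · have := Nat.card_pos (α := H)
      have := Nat.card_pos (α := K)
      simp at h
    · exact hc
  set f : G → ℕ := fun x => (Subgroup.centralizer {x}).relIndex K with hf
  set HF : Finset G := Finset.univ.filter (· ∈ H) with hHF
  set X : Finset G := HF.filter (fun x => f x ≤ c) with hXdef
  have hHcard : HF.card = Nat.card H := by
    rw [Nat.card_eq_fintype_card, Fintype.card_subtype]
  have hcent (x : G) :
      Nat.card (Subgroup.centralizer {x} ⊓ K : Subgroup G) * f x = Nat.card K := by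
    have := Subgroup.relIndex_mul_relIndex ⊥ (Subgroup.centralizer {x} ⊓ K) K bot_le inf_le_right
    rwa [Subgroup.relIndex_bot_left, Subgroup.relIndex_bot_left, Subgroup.inf_relIndex_right]
      at this
  have hcount : {p : G × G | p.1 ∈ H ∧ p.2 ∈ K ∧ Commute p.1 p.2}.ncard =
      ∑ x ∈ HF, Nat.card (Subgroup.centralizer {x} ⊓ K : Subgroup G) := by
    rw [Set.ncard_eq_toFinset_card', Finset.card_eq_sum_card_fiberwise (f := Prod.fst) (t := HF)]
    · refine Finset.sum_congr rfl fun x hx => ?_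
      have hxH : x ∈ H := by simpa [hHF] using hx
      rw [Nat.card_eq_fintype_card, Fintype.card_subtype]
      refine Finset.card_nbij' Prod.snd (fun y => (x, y)) ?_ ?_ ?_ ?_
      · rintro ⟨a, b⟩ hab
        simp only [Finset.coe_filter, Set.mem_toFinset, Set.mem_ofPred_eq, Finset.mem_univ,
          true_and, Subgroup.mem_inf, Subgroup.mem_centralizer_singleton_iff] at hab ⊢
        obtain ⟨⟨_, hb, hcomm⟩, rfl⟩ := hab
        exact ⟨hcomm.symm, hb⟩
      · intro b hb
        simp only [Finset.coe_filter, Set.mem_toFinset, Set.mem_ofPred_eq, Finset.mem_univ,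
          true_and, Subgroup.mem_inf, Subgroup.mem_centralizer_singleton_iff] at hb ⊢
        exact ⟨⟨hxH, hb.2, hb.1.symm⟩, trivial⟩
      · rintro ⟨a, b⟩ hab
        simp only [Finset.coe_filter, Set.mem_ofPred_eq] at hab
        simp [hab.2]
      · intro b _
        rfl
    · intro p hp
      simp only [Set.coe_toFinset, Set.mem_ofPred_eq] at hp
      simpa [hHF] using hp.1
  -- Elements outside `X` have centralizers of order below `|K| / c`. Their total is the last term,
  -- which the factor `2` in `h` absorbs.
  have hsum : c * ∑ x ∈ HF, Nat.card (Subgroup.centralizer {x} ⊓ K : Subgroup G) ≤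
      c * X.card * Nat.card K + HF.card * Nat.card K := by
    calc c * ∑ x ∈ HF, Nat.card (Subgroup.centralizer {x} ⊓ K : Subgroup G)
        = ∑ x ∈ HF, c * Nat.card (Subgroup.centralizer {x} ⊓ K : Subgroup G) := Finset.mul_sum ..
      _ ≤ ∑ x ∈ HF, ((if f x ≤ c then c * Nat.card K else 0) + Nat.card K) := by
          refine Finset.sum_le_sum fun x _ => ?_
          have hx := hcent x
          split_ifs with hfx
          · have hle : Nat.card (Subgroup.centralizer {x} ⊓ K : Subgroup G) ≤ Nat.card K :=
              Nat.card_mono (Set.toFinite _) inf_le_right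
            exact (Nat.mul_le_mul_left c hle).trans (Nat.le_add_right _ _)
          · rw [← hx, zero_add, mul_comm]
            exact Nat.mul_le_mul_left _ (by omega)
      _ = c * X.card * Nat.card K + HF.card * Nat.card K := by
          rw [Finset.sum_add_distrib, ← Finset.sum_filter, Finset.sum_const, Finset.sum_const,
            smul_eq_mul, smul_eq_mul]
          ring
  have hXcard : Nat.card H ≤ c * X.card := by
    have hK := Nat.card_pos (α := K)
    rw [hcount] at h
    rw [hHcard] at hsum
    exact Nat.le_of_mul_le_mul_right (by linarith) hK
  have hXH : (X : Set G) ⊆ H := by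
    intro x hx
    simp only [hXdef, hHF, Finset.coe_filter, Finset.mem_filter, Finset.mem_univ, true_and,
      Set.mem_ofPred_eq] at hx
    exact hx.1
  have hXf (x : G) (hx : x ∈ X) : f x ≤ c := (Finset.mem_filter.mp hx).2
  have hf1 : f 1 = 1 := by
    simp only [hf]
    rw [Subgroup.relIndex_eq_one]
    intro g _
    simp [Subgroup.mem_centralizer_singleton_iff]
  have h1X : 1 ∈ X := by
    simp only [hXdef, hHF, Finset.mem_filter, Finset.mem_univ, true_and, hf1]
    exact ⟨H.one_mem, hc⟩
  have hinv : ∀ x ∈ X, x⁻¹ ∈ X := by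
    intro x hx
    simp only [hXdef, hHF, hf, Finset.mem_filter, Finset.mem_univ, true_and,
      centralizer_singleton_inv] at hx ⊢
    exact ⟨H.inv_mem hx.1, hx.2⟩
  have hBH : Subgroup.closure (X : Set G) ≤ H := (Subgroup.closure_le H).mpr hXH
  refine ⟨Subgroup.closure X, hBH, ?_, ?_⟩
  · have h1 := Subgroup.relIndex_mul_relIndex ⊥ _ H bot_le hBH
    rw [Subgroup.relIndex_bot_left, Subgroup.relIndex_bot_left] at h1
    have h2 : X.card ≤ Nat.card (Subgroup.closure (X : Set G)) := by
      have := Set.ncard_le_ncard (Subgroup.subset_closure (k := (X : Set G))) (Set.toFinite _)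
      rw [Set.ncard_coe_finset] at this
      exact this
    have h3 := Nat.card_pos (α := Subgroup.closure (X : Set G))
    refine Nat.le_of_mul_le_mul_left ?_ h3
    rw [h1]
    calc Nat.card H ≤ c * X.card := hXcard
      _ ≤ c * Nat.card (Subgroup.closure (X : Set G)) := Nat.mul_le_mul_left _ h2
      _ = _ := mul_comm _ _
  · intro b hb
    have key : ∀ n, ∀ x ∈ X ^ n, f x ≤ c ^ n := by
      intro n
      induction n with
      | zero =>
        intro x hx
        rw [pow_zero, Finset.mem_one] at hx
        simp [hx, hf1]
      | succ n ih =>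
        intro x hx
        rw [pow_succ, Finset.mem_mul] at hx
        obtain ⟨y, hy, z, hz, rfl⟩ := hx
        rw [pow_succ]
        exact (relIndex_centralizer_mul_le K y z).trans (Nat.mul_le_mul (ih y hy) (hXf z hz))
    exact key _ b (closure_subset_pow_of_card_le h1X hinv hXH hXcard hb)

end CentralizerIndex

/-! ### From few conjugates to a bounded commutator subgroup. -/

section CommutatorBound

open scoped commutatorElement IsMulCommutative

variable {G : Type u} [Group G]

theorem index_normalCore_le_factorial (H : Subgroup G) [H.FiniteIndex] :
    H.normalCore.index ≤ H.index.factorial := by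
  refine Nat.le_of_dvd (Nat.factorial_pos _) ?_
  rw [Subgroup.normalCore_eq_ker, Subgroup.index_ker, Subgroup.index_eq_card, ← Nat.card_perm]
  exact Subgroup.card_subgroup_dvd_card _

/-- An abelian group of exponent dividing `n` and rank at most `k` has order dividing a power of `n`
of exponent at most `k`. -/
theorem card_closure_le_of_commute [Finite G] {S : Set G} {k n : ℕ} (hn : 0 < n)
    (hk : S.ncard ≤ k) (hcomm : ∀ x ∈ S, ∀ y ∈ S, x * y = y * x) (hpow : ∀ x ∈ S, x ^ n = 1) :
    Nat.card (Subgroup.closure S) ≤ n ^ k := by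
  have := Subgroup.isMulCommutative_closure hcomm
  have hall (g : Subgroup.closure S) : g ^ n = 1 := by
    obtain ⟨g, hg⟩ := g
    rw [Subtype.ext_iff]
    simp only [SubmonoidClass.mk_pow, OneMemClass.coe_one]
    have hc (x y : G) (hx : x ∈ Subgroup.closure S) (hy : y ∈ Subgroup.closure S) :
        Commute x y :=
      congrArg Subtype.val (mul_comm (⟨x, hx⟩ : Subgroup.closure S) ⟨y, hy⟩)
    induction hg using Subgroup.closure_induction with
    | mem x hx => exact hpow x hx
    | one => exact one_pow n
    | mul x y hx hy ihx ihy => rw [(hc x y hx hy).mul_pow, ihx, ihy, one_mul]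
    | inv x _ ih => rw [inv_pow, ih, inv_one]
  refine (Nat.le_of_dvd (pow_pos hn _) (card_dvd_exponent_pow_rank' _ hall)).trans ?_
  exact Nat.pow_le_pow_right hn ((Subgroup.rank_closure_finite_le_nat_card S).trans hk)

theorem commutatorElement_pow_right {g u : G} (h : Commute ⁅g, u⁆ u) (j : ℕ) :
    ⁅g, u ^ j⁆ = ⁅g, u⁆ ^ j := by
  have h1 : g * u * g⁻¹ = ⁅g, u⁆ * u := by simp [commutatorElement_def]
  have h2 : g * u ^ j * g⁻¹ = ⁅g, u⁆ ^ j * u ^ j := by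
    rw [← conj_pow, h1, h.mul_pow]
  rw [commutatorElement_def, h2, mul_inv_cancel_right]

/-- If the elements of `B` have at most `m` conjugates under `T` and conversely, then `B` has a
subgroup of bounded index having boundedly many commutators with `T`. -/
theorem exists_ncard_commutators_le [Finite G] {B T : Subgroup G} {m : ℕ}
    (hB : ∀ b ∈ B, (Subgroup.centralizer {b}).relIndex T ≤ m)
    (hT : ∀ t ∈ T, (Subgroup.centralizer {t}).relIndex B ≤ m) :
    ∃ U ≤ B, U.relIndex B ≤ m ^ m ∧
      {x | ∃ g ∈ T, ∃ u ∈ U, ⁅g, u⁆ = x}.ncard ≤ m ^ 2 := by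
  classical
  obtain ⟨a, haB, hmax⟩ : ∃ a ∈ B, ∀ b ∈ B,
      (Subgroup.centralizer {b}).relIndex T ≤ (Subgroup.centralizer {a}).relIndex T :=
    Set.exists_max_image (B : Set G) (fun b => (Subgroup.centralizer {b}).relIndex T)
      (Set.toFinite _) ⟨1, B.one_mem⟩
  have hm : 0 < m := lt_of_lt_of_le
    (Nat.pos_of_ne_zero Subgroup.FiniteIndex.index_ne_zero) (hB 1 B.one_mem)
  set orb : G → Set G := fun b => {x | ∃ t ∈ T, t * b * t⁻¹ = x} with horb
  have horbcard (b : G) : (orb b).ncard = (Subgroup.centralizer {b}).relIndex T :=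
    ncard_conj_eq_relIndex_centralizer T b
  have hO : (orb a).ncard ≤ m := (horbcard a).trans_le (hB a haB)
  choose! τ hτT hτ using fun (o : G) (ho : o ∈ orb a) => ho
  have hτcard : (τ '' orb a).ncard ≤ m := (Set.ncard_image_le (Set.toFinite _)).trans hO
  refine ⟨B ⊓ Subgroup.centralizer (τ '' orb a), inf_le_left, ?_, ?_⟩
  · rw [Subgroup.inf_relIndex_left]
    refine relIndex_centralizer_le_pow B ?_ hτcard hm
    rintro _ ⟨o, ho, rfl⟩
    exact hT _ (hτT o ho)
  · have hsub : {x | ∃ g ∈ T, ∃ u ∈ B ⊓ Subgroup.centralizer (τ '' orb a), ⁅g, u⁆ = x} ⊆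
        (fun p : G × G => p.1⁻¹ * p.2) '' (orb a ×ˢ orb a) := by
      rintro _ ⟨g, hg, u, hu, rfl⟩
      obtain ⟨huB, huC⟩ := Subgroup.mem_inf.mp hu
      -- Since `u` commutes with the chosen conjugators `τ o`, the left side lies in the right;
      -- maximality of the orbit of `a` forces equality.
      have himg : (fun o => o * u) '' orb a = orb (a * u) := by
        refine Set.eq_of_subset_of_ncard_le ?_ ?_ (Set.toFinite _)
        · rintro _ ⟨o, ho, rfl⟩
          refine ⟨τ o, hτT o ho, ?_⟩
          have hcomm : τ o * u = u * τ o :=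
            Subgroup.mem_centralizer_iff.mp huC _ (Set.mem_image_of_mem τ ho)
          calc τ o * (a * u) * (τ o)⁻¹ = τ o * a * (u * (τ o)⁻¹) := by group
            _ = τ o * a * ((τ o)⁻¹ * u) := by
              rw [(show Commute (τ o) u from hcomm).symm.inv_right.eq]
            _ = (τ o * a * (τ o)⁻¹) * u := by group
            _ = o * u := by rw [hτ o ho]
        · rw [Set.ncard_image_of_injective _ (mul_left_injective u), horbcard, horbcard]
          exact hmax _ (B.mul_mem haB huB)
      have hmem : g * (a * u) * g⁻¹ ∈ orb (a * u) := ⟨g, hg, rfl⟩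
      rw [← himg] at hmem
      obtain ⟨o, ho, heq⟩ := hmem
      refine ⟨(g * a * g⁻¹, o), ⟨⟨g, hg, rfl⟩, ho⟩, ?_⟩
      have ho' : o = g * (a * u) * g⁻¹ * u⁻¹ := eq_mul_inv_of_mul_eq heq
      simp only [ho', commutatorElement_def]
      group
    refine (Set.ncard_le_ncard hsub (Set.toFinite _)).trans ?_
    refine (Set.ncard_image_le (Set.toFinite _)).trans ?_
    rw [Set.ncard_prod, sq]
    exact Nat.mul_le_mul hO hO

/-- If the normal subgroup `T` has at most `k` commutators with `U`, then suitable subgroups of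
bounded index in `T` and `U` have a commutator subgroup of bounded order. -/
theorem exists_card_commutator_le_of_ncard_commutators_le [Finite G] {T U : Subgroup G}
    [T.Normal] {k : ℕ} (hk : {x | ∃ g ∈ T, ∃ u ∈ U, ⁅g, u⁆ = x}.ncard ≤ k) :
    ∃ T₁ U₁ : Subgroup G, T₁.Normal ∧ U₁ ≤ U ∧
      T₁.index ≤ ((k ^ 2) ^ k * T.index).factorial ∧ U₁.relIndex U ≤ k ^ k ∧
      Nat.card (⁅T₁, U₁⁆ : Subgroup G) ≤ k.factorial ^ k := by
  set S : Set G := {x | ∃ g ∈ T, ∃ u ∈ U, ⁅g, u⁆ = x} with hS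
  have hk0 : 0 < k := by
    refine lt_of_lt_of_le ?_ hk
    rw [Set.ncard_pos]
    exact ⟨⁅1, 1⁆, 1, T.one_mem, 1, U.one_mem, rfl⟩
  have hT : (Subgroup.centralizer S).relIndex T ≤ (k ^ 2) ^ k := by
    refine relIndex_centralizer_le_pow T ?_ hk (pow_pos hk0 2)
    rintro _ ⟨g, hg, u, hu, rfl⟩
    rw [← ncard_conj_eq_relIndex_centralizer]
    have hsub : {x | ∃ t ∈ T, t * ⁅g, u⁆ * t⁻¹ = x} ⊆
        (fun p : G × G => p.1 * p.2⁻¹) '' (S ×ˢ S) := by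
      rintro _ ⟨t, ht, rfl⟩
      -- The identity used is `t * ⁅g, u⁆ * t⁻¹ = ⁅t * g, u⁆ * ⁅t, u⁆⁻¹`.
      refine ⟨(⁅t * g, u⁆, ⁅t, u⁆), ⟨⟨_, T.mul_mem ht hg, u, hu, rfl⟩, ⟨t, ht, u, hu, rfl⟩⟩, ?_⟩
      simp only [commutatorElement_def]
      group
    refine (Set.ncard_le_ncard hsub (Set.toFinite _)).trans ?_
    refine (Set.ncard_image_le (Set.toFinite _)).trans ?_
    rw [Set.ncard_prod, sq]
    exact Nat.mul_le_mul hk hk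
  have hU : (Subgroup.centralizer S).relIndex U ≤ k ^ k := by
    refine relIndex_centralizer_le_pow U ?_ hk hk0
    rintro _ ⟨g, hg, u, hu, rfl⟩
    rw [← ncard_conj_eq_relIndex_centralizer]
    refine (Set.ncard_le_ncard ?_ (Set.toFinite _)).trans hk
    rintro _ ⟨v, hv, rfl⟩
    refine ⟨v * g * v⁻¹, Subgroup.Normal.conj_mem ‹_› g hg v, v * u * v⁻¹,
      U.mul_mem (U.mul_mem hv hu) (U.inv_mem hv), ?_⟩
    simp only [commutatorElement_def]
    group
  have hcoreT : (T ⊓ Subgroup.centralizer S).normalCore ≤ T :=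
    (Subgroup.normalCore_le _).trans inf_le_left
  have hcoreC : (T ⊓ Subgroup.centralizer S).normalCore ≤ Subgroup.centralizer S :=
    (Subgroup.normalCore_le _).trans inf_le_right
  refine ⟨(T ⊓ Subgroup.centralizer S).normalCore, U ⊓ Subgroup.centralizer S, inferInstance,
    inf_le_left, ?_, ?_, ?_⟩
  · refine (index_normalCore_le_factorial _).trans (Nat.factorial_le ?_)
    rw [← Subgroup.relIndex_mul_index (inf_le_left : T ⊓ Subgroup.centralizer S ≤ T),
      Subgroup.inf_relIndex_left]
    exact Nat.mul_le_mul_right _ hT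
  · rwa [Subgroup.inf_relIndex_left]
  · set T₁ := (T ⊓ Subgroup.centralizer S).normalCore with hT₁
    have hT₁n : T₁.Normal := inferInstance
    rw [Subgroup.commutator_def]
    have hsub : {x | ∃ g₁ ∈ T₁, ∃ g₂ ∈ U ⊓ Subgroup.centralizer S, ⁅g₁, g₂⁆ = x} ⊆ S := by
      rintro _ ⟨g, hg, u, hu, rfl⟩
      exact ⟨g, hcoreT hg, u, hu.1, rfl⟩
    -- Normality puts the commutators inside `T₁`, which centralizes `S`; hence they commute with
    -- one another.
    have hmemT : ∀ x ∈ {x | ∃ g₁ ∈ T₁, ∃ g₂ ∈ U ⊓ Subgroup.centralizer S, ⁅g₁, g₂⁆ = x},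
        x ∈ T₁ := by
      rintro _ ⟨g, hg, u, hu, rfl⟩
      rw [commutatorElement_def, mul_assoc, mul_assoc]
      refine T₁.mul_mem hg ?_
      rw [← mul_assoc]
      exact hT₁n.conj_mem _ (T₁.inv_mem hg) u
    refine card_closure_le_of_commute (Nat.factorial_pos k)
      ((Set.ncard_le_ncard hsub (Set.toFinite _)).trans hk) ?_ ?_
    · intro x hx y hy
      exact (Subgroup.mem_centralizer_iff.mp (hcoreC (hmemT y hy)) x (hsub hx))
    · rintro _ ⟨g, hg, u, hu, rfl⟩
      have hcomm : Commute ⁅g, u⁆ u :=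
        Subgroup.mem_centralizer_iff.mp hu.2 _ (hsub ⟨g, hg, u, hu, rfl⟩)
      -- Powers of `⁅g, u⁆` are the commutators `⁅g, u ^ j⁆`, again in `S`, so its order is at most
      -- `k` and divides `k.factorial`.
      have hpow : (Subgroup.zpowers ⁅g, u⁆ : Set G) ⊆ S := by
        intro y hy
        obtain ⟨j, rfl⟩ := (mem_powers_iff_mem_zpowers (x := ⁅g, u⁆)).mpr hy
        exact ⟨g, hcoreT hg, u ^ j, U.pow_mem hu.1 j, commutatorElement_pow_right hcomm j⟩
      have hord : orderOf ⁅g, u⁆ ≤ k := by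
        rw [← Nat.card_zpowers]
        exact (Set.ncard_le_ncard hpow (Set.toFinite _)).trans hk
      exact orderOf_dvd_iff_pow_eq_one.mp (Nat.dvd_factorial (orderOf_pos _) hord)

end CommutatorBound

/-! ### Commuting probability and Neumann's theorem. -/

section CommutingProbability

/-- A subgroup `K` commuting with `G` with probability at least `2 / c` has a subgroup of bounded
index whose commutator subgroup with some normal subgroup of bounded index is bounded. -/
theorem exists_bound_of_ncard_commuting_pairs (c : ℕ) :
    ∃ N : ℕ, ∀ (G : Type u) [Group G] [Finite G] (K : Subgroup G),
      2 * (Nat.card K * Nat.card G) ≤ c * {p : G × G | p.1 ∈ K ∧ Commute p.1 p.2}.ncard →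
        ∃ T B : Subgroup G, T.Normal ∧ B ≤ K ∧
          T.index ≤ N ∧ B.relIndex K ≤ N ∧ Nat.card (⁅T, B⁆ : Subgroup G) ≤ N := by
  set m := c ^ (3 * c)
  set k := m ^ 2
  refine ⟨((k ^ 2) ^ k * c.factorial).factorial + k ^ k * (m ^ m * c) + k.factorial ^ k, ?_⟩
  intro G _ _ K h
  obtain ⟨B, hBK, hBi, hB⟩ := exists_le_relIndex_centralizer_le (H := K) (K := (⊤ : Subgroup G))
    (c := c) (by simpa using h)
  obtain ⟨T, -, hTi, hT⟩ := exists_le_relIndex_centralizer_le (H := (⊤ : Subgroup G)) (K := K)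
    (c := c) (by
      have hswap : {p : G × G | p.1 ∈ (⊤ : Subgroup G) ∧ p.2 ∈ K ∧ Commute p.1 p.2} =
          Prod.swap '' {p : G × G | p.1 ∈ K ∧ Commute p.1 p.2} := by
        ext ⟨x, y⟩
        simp [Set.mem_image, Prod.exists, Commute.symm_iff (a := x)]
      rw [hswap, Set.ncard_image_of_injective _ Prod.swap_injective, Subgroup.card_top, mul_comm]
      simpa [mul_comm, mul_left_comm] using h)
  rw [Subgroup.relIndex_top_right] at hTi
  obtain ⟨U, hUB, hUi, hU⟩ := exists_ncard_commutators_le (B := B) (T := T.normalCore) (m := m)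
    (fun b hb => (Subgroup.relIndex_le_of_le_right le_top
      Subgroup.FiniteIndex.index_ne_zero).trans (hB b hb))
    (fun t ht => (Subgroup.relIndex_le_of_le_right hBK
      Subgroup.FiniteIndex.index_ne_zero).trans (hT t (T.normalCore_le ht)))
  obtain ⟨T₁, U₁, hn, hU₁, hT₁i, hU₁i, hcard⟩ :=
    exists_card_commutator_le_of_ncard_commutators_le hU
  refine ⟨T₁, U₁, hn, hU₁.trans (hUB.trans hBK), ?_, ?_, ?_⟩
  · have h1 : T.normalCore.index ≤ c.factorial :=
      (index_normalCore_le_factorial T).trans (Nat.factorial_le hTi)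
    have h2 := hT₁i.trans (Nat.factorial_le (Nat.mul_le_mul_left ((k ^ 2) ^ k) h1))
    omega
  · have h1 : U₁.relIndex K ≤ k ^ k * (m ^ m * c) := by
      rw [← Subgroup.relIndex_mul_relIndex U₁ U K hU₁ (hUB.trans hBK),
        ← Subgroup.relIndex_mul_relIndex U B K hUB hBK]
      exact Nat.mul_le_mul hU₁i (Nat.mul_le_mul hUi hBi)
    omega
  · exact hcard.trans (Nat.le_add_left _ _)

theorem two_mul_le_ceil_mul_of_le_div {ε : ℝ} (hε : 0 < ε) {P Q : ℕ} (hQ : 0 < Q)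
    (h : ε ≤ (P : ℝ) / Q) : 2 * Q ≤ ⌈2 / ε⌉₊ * P := by
  have hQ' : (0 : ℝ) < Q := by exact_mod_cast hQ
  rw [le_div_iff₀ hQ'] at h
  have h1 : (2 : ℝ) ≤ ⌈2 / ε⌉₊ * ε := (div_le_iff₀ hε).mp (Nat.le_ceil _)
  have h2 : (2 : ℝ) * Q ≤ ⌈2 / ε⌉₊ * P := by
    calc (2 : ℝ) * Q ≤ ⌈2 / ε⌉₊ * ε * Q := mul_le_mul_of_nonneg_right h1 hQ'.le
      _ = ⌈2 / ε⌉₊ * (ε * Q) := by ring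
      _ ≤ ⌈2 / ε⌉₊ * P := mul_le_mul_of_nonneg_left h (Nat.cast_nonneg _)
  exact_mod_cast h2

theorem natCard_commuting_pairs {G : Type u} [Group G] (K : Subgroup G) :
    Nat.card {p : K × G // (p.1 : G) * p.2 = p.2 * (p.1 : G)} =
      {p : G × G | p.1 ∈ K ∧ Commute p.1 p.2}.ncard := by
  refine Nat.card_congr
    ⟨fun p => ⟨(p.1.1, p.1.2), p.1.1.2, p.2⟩, fun p => ⟨(⟨p.1.1, p.2.1⟩, p.1.2), p.2.2⟩, ?_, ?_⟩
  · intro p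
    rfl
  · intro p
    rfl

theorem relCommProb_top (G : Type u) [Group G] :
    relCommProb (⊤ : Subgroup G) = commProb G := by
  rw [relCommProb, commProb_def, natCard_commuting_pairs, Subgroup.card_top, sq]
  simp only [Subgroup.mem_top, true_and]
  rfl

/-- A normal subgroup `M` contains the normal subgroup `M ⊓ C([M, M])`, of class at most two. -/
theorem exists_normal_nilpotencyClass_le_two {G : Type u} [Group G] [Finite G] {M : Subgroup G}
    [M.Normal] {N : ℕ} (hN : Nat.card (⁅M, M⁆ : Subgroup G) ≤ N) :
    ∃ R ≤ M, R.Normal ∧ Group.IsNilpotent R ∧ Group.nilpotencyClass R ≤ 2 ∧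
      R.index ≤ N ^ N * M.index := by
  set D : Subgroup G := ⁅M, M⁆ with hD
  have hN0 : 0 < N := lt_of_lt_of_le Nat.card_pos hN
  have hR : (M ⊓ Subgroup.centralizer (D : Set G)).lowerCentralSeries 2 = ⊥ := by
    set R := M ⊓ Subgroup.centralizer (D : Set G) with hRdef
    rw [Subgroup.lowerCentralSeries_succ, Subgroup.lowerCentralSeries_succ,
      Subgroup.lowerCentralSeries_zero, Subgroup.commutator_eq_bot_iff_le_centralizer]
    intro x hx
    have hxD : x ∈ D := Subgroup.commutator_mono inf_le_left inf_le_left hx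
    rw [Subgroup.mem_centralizer_iff]
    intro r hr
    exact (Subgroup.mem_centralizer_iff.mp hr.2 x hxD).symm
  have hnil : Group.IsNilpotent (M ⊓ Subgroup.centralizer (D : Set G) : Subgroup G) :=
    (Subgroup.isNilpotent_iff_lowerCentralSeries _).mpr ⟨2, hR⟩
  refine ⟨M ⊓ Subgroup.centralizer (D : Set G), inf_le_left, inferInstance, hnil, ?_, ?_⟩
  · rw [← Subgroup.lowerCentralSeries_eq_bot_iff_nilpotencyClass_le]
    rw [← Subgroup.map_eq_bot_iff_of_injective _ (Subgroup.subtype_injective _),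
      Subgroup.top_subtype_lowerCentralSeries, hR]
  · rw [← Subgroup.relIndex_mul_index
      (inf_le_left : M ⊓ Subgroup.centralizer (D : Set G) ≤ M), Subgroup.inf_relIndex_left]
    -- `D` is normal with at most `N` elements, so each has at most `N` conjugates.
    refine Nat.mul_le_mul_right _ (relIndex_centralizer_le_pow M ?_ hN hN0)
    intro s hs
    rw [← ncard_conj_eq_relIndex_centralizer]
    refine (Set.ncard_le_ncard ?_ (Set.toFinite (D : Set G))).trans hN
    rintro _ ⟨t, -, rfl⟩
    exact Subgroup.Normal.conj_mem inferInstance s hs t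

end CommutingProbability

theorem mainTheorem1 :
    (∀ ε : ℝ, 0 < ε → ∃ N : ℕ, ∀ (G : Type u) [Group G] [Finite G] (K : Subgroup G),
      ε ≤ (relCommProb K : ℝ) →
        ∃ T B : Subgroup G, T.Normal ∧ B ≤ K ∧
          T.index ≤ N ∧ B.relIndex K ≤ N ∧ Nat.card (⁅T, B⁆ : Subgroup G) ≤ N) ∧
    (∀ ε : ℝ, 0 < ε → ∃ N : ℕ, ∀ (G : Type u) [Group G] [Finite G],
      ε ≤ (commProb G : ℝ) →
        ∃ R : Subgroup G, R.Normal ∧ Group.IsNilpotent R ∧ Group.nilpotencyClass R ≤ 2 ∧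
          R.index ≤ N ∧ Nat.card (⁅R, R⁆ : Subgroup G) ≤ N) := by
  have relative : ∀ ε : ℝ, 0 < ε → ∃ N : ℕ, ∀ (G : Type u) [Group G] [Finite G] (K : Subgroup G),
      ε ≤ (relCommProb K : ℝ) →
        ∃ T B : Subgroup G, T.Normal ∧ B ≤ K ∧
          T.index ≤ N ∧ B.relIndex K ≤ N ∧ Nat.card (⁅T, B⁆ : Subgroup G) ≤ N := by
    intro ε hε
    obtain ⟨N, hN⟩ := exists_bound_of_ncard_commuting_pairs.{u} ⌈2 / ε⌉₊
    refine ⟨N, fun G _ _ K h => hN G K ?_⟩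
    refine two_mul_le_ceil_mul_of_le_div hε (Nat.mul_pos Nat.card_pos Nat.card_pos) ?_
    rw [relCommProb, natCard_commuting_pairs] at h
    push_cast at h ⊢
    exact h
  refine ⟨relative, fun ε hε => ?_⟩
  obtain ⟨N, hN⟩ := relative ε hε
  refine ⟨N ^ N * (N * N).factorial + N, fun G _ _ h => ?_⟩
  obtain ⟨T, B, -, -, hT, hB, hcard⟩ := hN G ⊤ (by rwa [relCommProb_top])
  rw [Subgroup.relIndex_top_right] at hB
  -- This core is normal of bounded index, and its commutator subgroup lies in `⁅T, B⁆`.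
  have hMT : (T ⊓ B).normalCore ≤ T := (Subgroup.normalCore_le _).trans inf_le_left
  have hMB : (T ⊓ B).normalCore ≤ B := (Subgroup.normalCore_le _).trans inf_le_right
  have hM : Nat.card (⁅(T ⊓ B).normalCore, (T ⊓ B).normalCore⁆ : Subgroup G) ≤ N :=
    (Nat.card_mono (Set.toFinite _) (Subgroup.commutator_mono hMT hMB)).trans hcard
  have hMi : (T ⊓ B).normalCore.index ≤ (N * N).factorial :=
    (index_normalCore_le_factorial _).trans
      (Nat.factorial_le (Subgroup.index_inf_le.trans (Nat.mul_le_mul hT hB)))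
  obtain ⟨R, hRM, hn, hnil, hclass, hRi⟩ := exists_normal_nilpotencyClass_le_two hM
  refine ⟨R, hn, hnil, hclass, ?_, ?_⟩
  · exact (hRi.trans (Nat.mul_le_mul_left _ hMi)).trans (Nat.le_add_right _ _)
  · exact ((Nat.card_mono (Set.toFinite _) (Subgroup.commutator_mono hRM hRM)).trans hM).trans
      (Nat.le_add_left _ _)
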